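/- Let $G$ be a locally compact Hausdorff group with left Haar measure $\nu$, and let $\Gamma\le G$ be a cocompact lattice, i.e. a discrete subgroup such that $G/\Gamma$ is compact and carries a nonzero finite $G$-invariant Radon measure $\mu$. For a unitary representation $\rho$ of $\Gamma$ on a complex Hilbert space $V$, let $\mathrm{Ind}_\Gamma^G\rho$ be the induced representation of $G$: its Hilbert space is the completion of the space of continuous functions $\varphi:G\to V$ with $\varphi(g\gamma)=\rho(\gamma)^{-1}\varphi(g)$ for all $g\in G$, $\gamma\in\Gamma$, with respect to $\langle\varphi,\psi\rangle=\int_{G/\Gamma}\langle\varphi(g),\psi(g)\rangle\,d\mu(g\Gamma)$, and $G$ acts by $(\pi(g)\varphi)(h)=\varphi(g^{-1}h)$. Let $\rho_i$ $(i\in\mathbb N)$ and $\rho_\infty$ be unitary representations of $\Gamma$ on arbitrary complex Hilbert spaces. Suppose that $\rho_i$ converges strongly to $\rho_\infty$, i.e. for every $z\in\mathbb C[\Gamma]$, $$\lim_{i\to\infty}\|\rho_i(z)\|=\|\rho_\infty(z)\|.$$ Then $\mathrm{Ind}_\Gamma^G\rho_i$ converges strongly to $\mathrm{Ind}_\Gamma^G\rho_\infty$,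 i.e. with $\pi_i=\mathrm{Ind}_\Gamma^G\rho_i$, $\pi_\infty=\mathrm{Ind}_\Gamma^G\rho_\infty$ and $\pi(f)=\int_G f(g)\,\pi(g)\,d\nu(g)$, for every continuous compactly supported $f:G\to\mathbb C$, $$\lim_{i\to\infty}\|\pi_i(f)\|=\|\pi_\infty(f)\|.$$ All norms are operator norms. -/

import Mathlib

open Filter Topology MeasureTheory
open scoped CompactlySupported

noncomputable section

namespace StrongInduction

/-! ### Unitary representations and strong convergence -/

section Discrete

variable {Γ : Type*} [Group Γ]
  {H : Type*} [NormedAddCommGroup H] [InnerProductSpace ℂ H] [CompleteSpace H]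

/-- For a unitary representation `ρ` of an abstract (discrete) group `Γ` and `z ∈ ℂ[Γ]`, the
bounded operator `ρ(z) = ∑_γ z(γ) ρ(γ)`. -/
def groupAlgebraOp (ρ : Γ →* unitary (H →L[ℂ] H)) (z : MonoidAlgebra ℂ Γ) : H →L[ℂ] H :=
  MonoidAlgebra.lift ℂ (H →L[ℂ] H) Γ ((unitary (H →L[ℂ] H)).subtype.comp ρ) z

/-- Strong convergence `ρ_i → ρ_∞` of unitary representations of a discrete group:
`‖ρ_i(z)‖ → ‖ρ_∞(z)‖` (operator norms) for all `z ∈ ℂ[Γ]`. -/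
def StronglyConverges
    {K : ℕ → Type*} [∀ i, NormedAddCommGroup (K i)] [∀ i, InnerProductSpace ℂ (K i)]
    [∀ i, CompleteSpace (K i)]
    (ρ : ∀ i, Γ →* unitary (K i →L[ℂ] K i)) (ρinf : Γ →* unitary (H →L[ℂ] H)) : Prop :=
  ∀ z : MonoidAlgebra ℂ Γ,
    Tendsto (fun i => ‖groupAlgebraOp (ρ i) z‖) atTop (𝓝 ‖groupAlgebraOp ρinf z‖)

end Discrete

/-- A (strongly continuous) unitary representation of a topological group `G` on a Hilbert
space `H`. -/
structure UnitaryRep (G : Type*) [Group G] [TopologicalSpace G]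
    (H : Type*) [NormedAddCommGroup H] [InnerProductSpace ℂ H] [CompleteSpace H] where
  /-- the underlying homomorphism to the unitary group of `H` -/
  toHom : G →* unitary (H →L[ℂ] H)
  /-- all orbit maps are continuous -/
  continuous_orbit : ∀ v : H, Continuous fun g => (toHom g : H →L[ℂ] H) v

section LocallyCompact

variable {G : Type*} [Group G] [TopologicalSpace G]
  {H : Type*} [NormedAddCommGroup H] [InnerProductSpace ℂ H] [CompleteSpace H]

theorem UnitaryRep.integrable_smul [MeasurableSpace G] [BorelSpace G]
    (ν : Measure G) [IsFiniteMeasureOnCompacts ν] (π : UnitaryRep G H) (f : C_c(G, ℂ)) (v : H) :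
    Integrable (fun g => f g • (π.toHom g : H →L[ℂ] H) v) ν := by
  refine Continuous.integrable_of_hasCompactSupport
    (f.continuous.smul (π.continuous_orbit v)) ?_
  exact f.hasCompactSupport.smul_right

/-- For `f ∈ C_c(G)`, the bounded operator `π(f) v = ∫_G f(g) π(g) v dν(g)`. -/
def UnitaryRep.op [MeasurableSpace G] [BorelSpace G]
    (ν : Measure G) [IsFiniteMeasureOnCompacts ν] (π : UnitaryRep G H) (f : C_c(G, ℂ)) :
    H →L[ℂ] H :=
  LinearMap.mkContinuous
    { toFun := fun v => ∫ g, f g • (π.toHom g : H →L[ℂ] H) v ∂ν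
      map_add' := fun v w => by
        rw [← integral_add (π.integrable_smul ν f v) (π.integrable_smul ν f w)]
        simp only [map_add, smul_add]
      map_smul' := fun c v => by
        simp only [map_smul, RingHom.id_apply]
        rw [← integral_smul]
        simp only [smul_comm c] }
    (∫ g, ‖f g‖ ∂ν)
    (fun v => by
      refine (norm_integral_le_integral_norm _).trans_eq ?_
      rw [← integral_mul_const]
      simp only [norm_smul, Unitary.norm_map])

/-- Strong convergence `π_i → π_∞` of unitary representations of a locally compact group `G` with
Haar measure `ν`: `‖π_i(f)‖ → ‖π_∞(f)‖` (operator norms) for all `f ∈ C_c(G)`. -/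
def UnitaryRep.StronglyConverges [MeasurableSpace G] [BorelSpace G]
    (ν : Measure G) [IsFiniteMeasureOnCompacts ν]
    {K : ℕ → Type*} [∀ i, NormedAddCommGroup (K i)] [∀ i, InnerProductSpace ℂ (K i)]
    [∀ i, CompleteSpace (K i)]
    (π : ∀ i, UnitaryRep G (K i)) (πinf : UnitaryRep G H) : Prop :=
  ∀ f : C_c(G, ℂ), Tendsto (fun i => ‖(π i).op ν f‖) atTop (𝓝 ‖πinf.op ν f‖)

end LocallyCompact

/-! ### Induced representations (compact quotient) -/

section Induced

variable {G : Type*} [Group G] [TopologicalSpace G] (Γ : Subgroup G)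
  {V : Type*} [NormedAddCommGroup V] [InnerProductSpace ℂ V] [CompleteSpace V]

/-- The space of continuous functions `φ : G → V` with `φ (g γ) = ρ(γ)⁻¹ φ(g)`. -/
def equivariantMaps (ρ : Γ →* unitary (V →L[ℂ] V)) : Submodule ℂ C(G, V) where
  carrier := {φ | ∀ (g : G) (γ : Γ), φ (g * γ) = (ρ γ⁻¹ : V →L[ℂ] V) (φ g)}
  add_mem' := fun {φ ψ} hφ hψ g γ => by simp [hφ g γ, hψ g γ]
  zero_mem' := fun g γ => by simp
  smul_mem' := fun c φ hφ g γ => by simp [hφ g γ]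

/-- The same space as `equivariantMaps Γ ρ`, as a type of its own; it carries the `L²` seminorm
over `G ⧸ Γ` with respect to `μ` introduced below. -/
def IndPre [MeasurableSpace (G ⧸ Γ)] (_μ : Measure (G ⧸ Γ))
    (ρ : Γ →* unitary (V →L[ℂ] V)) : Type _ :=
  equivariantMaps Γ ρ

namespace IndPre

variable [MeasurableSpace (G ⧸ Γ)] (μ : Measure (G ⧸ Γ)) (ρ : Γ →* unitary (V →L[ℂ] V))

instance : AddCommGroup (IndPre Γ μ ρ) := inferInstanceAs (AddCommGroup (equivariantMaps Γ ρ))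

instance : Module ℂ (IndPre Γ μ ρ) := inferInstanceAs (Module ℂ (equivariantMaps Γ ρ))

variable {Γ μ ρ}

/-- The underlying continuous function `G → V`. -/
def toMap (φ : IndPre Γ μ ρ) : C(G, V) := Subtype.val (p := (· ∈ equivariantMaps Γ ρ)) φ

/-- An equivariant continuous function as an element of `IndPre`. -/
def mk (φ : C(G, V)) (hφ : φ ∈ equivariantMaps Γ ρ) : IndPre Γ μ ρ :=
  (⟨φ, hφ⟩ : equivariantMaps Γ ρ)

theorem ext {φ ψ : IndPre Γ μ ρ} (h : ∀ g, φ.toMap g = ψ.toMap g) : φ = ψ :=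
  Subtype.ext (ContinuousMap.ext h)

@[simp] theorem toMap_mk (φ : C(G, V)) (hφ : φ ∈ equivariantMaps Γ ρ) :
    (mk φ hφ : IndPre Γ μ ρ).toMap = φ := rfl

@[simp] theorem toMap_add (φ ψ : IndPre Γ μ ρ) : (φ + ψ).toMap = φ.toMap + ψ.toMap := rfl

@[simp] theorem toMap_sub (φ ψ : IndPre Γ μ ρ) : (φ - ψ).toMap = φ.toMap - ψ.toMap := rfl

@[simp] theorem toMap_smul (c : ℂ) (φ : IndPre Γ μ ρ) : (c • φ).toMap = c • φ.toMap := rfl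

theorem toMap_mul (φ : IndPre Γ μ ρ) (g : G) (γ : Γ) :
    φ.toMap (g * γ) = (ρ γ⁻¹ : V →L[ℂ] V) (φ.toMap g) :=
  (Subtype.property (p := (· ∈ equivariantMaps Γ ρ)) φ) g γ

/-- The function `gΓ ↦ ⟪φ(g), ψ(g)⟫` on `G ⧸ Γ`. -/
def fiberInner (φ ψ : IndPre Γ μ ρ) : G ⧸ Γ → ℂ :=
  Quotient.lift (fun g => inner ℂ (φ.toMap g) (ψ.toMap g)) (fun a b hab => by
    have h : a⁻¹ * b ∈ Γ := QuotientGroup.leftRel_apply.mp hab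
    have hb : b = a * (⟨a⁻¹ * b, h⟩ : Γ) := by simp
    rw [hb, toMap_mul, toMap_mul, Unitary.inner_map_map])

@[simp] theorem fiberInner_mk (φ ψ : IndPre Γ μ ρ) (g : G) :
    fiberInner φ ψ (g : G ⧸ Γ) = inner ℂ (φ.toMap g) (ψ.toMap g) := rfl

theorem continuous_fiberInner (φ ψ : IndPre Γ μ ρ) : Continuous (fiberInner φ ψ) :=
  continuous_quot_lift _ (φ.toMap.continuous.inner ψ.toMap.continuous)

variable [CompactSpace (G ⧸ Γ)] [BorelSpace (G ⧸ Γ)] [IsFiniteMeasure μ]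

theorem integrable_fiberInner (φ ψ : IndPre Γ μ ρ) : Integrable (fiberInner φ ψ) μ :=
  (continuous_fiberInner φ ψ).integrable_of_hasCompactSupport
    (HasCompactSupport.of_compactSpace _)

variable (Γ μ ρ)

/-- The inner product `⟪φ, ψ⟫ = ∫_{G ⧸ Γ} ⟪φ(g), ψ(g)⟫ dμ(gΓ)`. -/
@[reducible] def core : PreInnerProductSpace.Core ℂ (IndPre Γ μ ρ) where
  inner φ ψ := ∫ x, fiberInner φ ψ x ∂μ
  conj_inner_symm φ ψ := by
    rw [← integral_conj]
    congr 1
    ext x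
    induction x using QuotientGroup.induction_on with
    | H g => simp
  re_inner_nonneg φ := by
    have h : ∀ x, 0 ≤ RCLike.re (fiberInner φ φ x) := fun x => by
      induction x using QuotientGroup.induction_on with
      | H g => simpa using inner_self_nonneg (𝕜 := ℂ) (x := φ.toMap g)
    rw [← integral_re (integrable_fiberInner φ φ)]
    exact integral_nonneg h
  add_left φ ψ χ := by
    rw [← integral_add (integrable_fiberInner φ χ) (integrable_fiberInner ψ χ)]
    congr 1
    ext x
    induction x using QuotientGroup.induction_on with
    | H g => simp
  smul_left φ ψ c := by
    rw [← integral_const_mul]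
    congr 1
    ext x
    induction x using QuotientGroup.induction_on with
    | H g => simp [mul_comm]

instance : SeminormedAddCommGroup (IndPre Γ μ ρ) :=
  @InnerProductSpace.Core.toSeminormedAddCommGroup ℂ (IndPre Γ μ ρ) _ _ _ (core Γ μ ρ)

instance : InnerProductSpace ℂ (IndPre Γ μ ρ) := InnerProductSpace.ofCore (core Γ μ ρ)

variable {Γ μ ρ}

theorem inner_def (φ ψ : IndPre Γ μ ρ) : inner ℂ φ ψ = ∫ x, fiberInner φ ψ x ∂μ := rfl

theorem norm_le_of_forall (φ : IndPre Γ μ ρ) {C : ℝ} (hC : 0 ≤ C)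
    (h : ∀ g, ‖φ.toMap g‖ ≤ C) : ‖φ‖ ≤ C * √(μ.real Set.univ) := by
  have h1 : ∀ x, ‖fiberInner φ φ x‖ ≤ C ^ 2 := fun x => by
    induction x using QuotientGroup.induction_on with
    | H g =>
      rw [fiberInner_mk, inner_self_eq_norm_sq_to_K, norm_pow]
      simpa using pow_le_pow_left₀ (norm_nonneg _) (h g) 2
  have h2 : ‖φ‖ ^ 2 ≤ C ^ 2 * μ.real Set.univ := by
    have h3 : ‖(inner ℂ φ φ : ℂ)‖ ≤ C ^ 2 * μ.real Set.univ :=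
      norm_integral_le_of_norm_le_const (Eventually.of_forall h1)
    rwa [inner_self_eq_norm_sq_to_K, norm_pow, RCLike.norm_ofReal, abs_norm] at h3
  refine abs_le_of_sq_le_sq' ?_ (by positivity) |>.2
  rwa [mul_pow, Real.sq_sqrt measureReal_nonneg]

variable [IsTopologicalGroup G] [SMulInvariantMeasure G (G ⧸ Γ) μ]

variable (Γ μ ρ) in
/-- Left translation `(T_g φ)(h) = φ(g⁻¹ h)`, a linear isometry for the `L²` seminorm. -/
def translate (g : G) : IndPre Γ μ ρ →ₗᵢ[ℂ] IndPre Γ μ ρ :=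
  LinearMap.isometryOfInner
    { toFun := fun φ => mk (φ.toMap.comp ⟨fun h => g⁻¹ * h, continuous_const_mul g⁻¹⟩)
        (fun h γ => by simp [← mul_assoc, toMap_mul])
      map_add' := fun φ ψ => rfl
      map_smul' := fun c φ => rfl }
    (fun φ ψ => by
      rw [inner_def, inner_def, ← integral_smul_eq_self (fiberInner φ ψ) (g := g⁻¹)]
      congr 1
      ext x
      induction x using QuotientGroup.induction_on with
      | H h => rfl)

@[simp] theorem translate_toMap (g : G) (φ : IndPre Γ μ ρ) (h : G) :
    (translate Γ μ ρ g φ).toMap h = φ.toMap (g⁻¹ * h) := rfl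

theorem translate_translate (g g' : G) (φ : IndPre Γ μ ρ) :
    translate Γ μ ρ g (translate Γ μ ρ g' φ) = translate Γ μ ρ (g * g') φ :=
  ext fun h => by simp [mul_assoc]

theorem translate_one (φ : IndPre Γ μ ρ) : translate Γ μ ρ 1 φ = φ :=
  ext fun h => by simp

theorem continuous_translate (φ : IndPre Γ μ ρ) :
    Continuous fun g => translate Γ μ ρ g φ := by
  rw [continuous_iff_continuousAt]
  intro g₀
  rw [ContinuousAt, tendsto_iff_norm_sub_tendsto_zero]
  have key : ∀ ε > 0, ∀ᶠ g in 𝓝 g₀, ∀ h : G, ‖φ.toMap (g⁻¹ * h) - φ.toMap (g₀⁻¹ * h)‖ ≤ ε := by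
    intro ε hε
    have h1 : ∀ᶠ g in 𝓝 g₀, ∀ y ∈ (Set.univ : Set (G ⧸ Γ)),
        ∀ h : G, (h : G ⧸ Γ) = y → ‖φ.toMap (g⁻¹ * h) - φ.toMap (g₀⁻¹ * h)‖ ≤ ε := by
      refine isCompact_univ.eventually_forall_of_forall_eventually fun y _ => ?_
      induction y using QuotientGroup.induction_on with
      | H h₀ =>
        have hq : IsOpenQuotientMap (Prod.map id ((↑) : G → G ⧸ Γ) : G × G → G × (G ⧸ Γ)) :=
          IsOpenQuotientMap.id.prodMap QuotientGroup.isOpenQuotientMap_mk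
        have hn := hq.map_nhds_eq (g₀, h₀)
        simp only [Prod.map_apply, id_eq] at hn
        rw [← hn, eventually_map]
        have hc : Continuous fun z : G × G =>
            ‖φ.toMap (z.1⁻¹ * z.2) - φ.toMap (g₀⁻¹ * z.2)‖ := by fun_prop
        have h2 : ∀ᶠ z : G × G in 𝓝 (g₀, h₀),
            ‖φ.toMap (z.1⁻¹ * z.2) - φ.toMap (g₀⁻¹ * z.2)‖ < ε :=
          hc.continuousAt.eventually_lt continuousAt_const (by simpa using hε)
        filter_upwards [h2] with z hz h hh
        have h3 : z.2⁻¹ * h ∈ Γ := QuotientGroup.eq.mp hh.symm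
        obtain ⟨γ, rfl⟩ : ∃ γ : Γ, h = z.2 * γ := ⟨⟨z.2⁻¹ * h, h3⟩, by simp⟩
        simp only [Prod.map_fst, id_eq]
        rw [ ← mul_assoc, ← mul_assoc, toMap_mul, toMap_mul, ← map_sub, Unitary.norm_map]
        exact hz.le
    filter_upwards [h1] with g hg h using hg _ (Set.mem_univ _) h rfl
  have key2 : ∀ ε > 0, ∀ᶠ g in 𝓝 g₀,
      ‖translate Γ μ ρ g φ - translate Γ μ ρ g₀ φ‖ ≤ ε * √(μ.real Set.univ) := by
    intro ε hε
    filter_upwards [key ε hε] with g hg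
    exact norm_le_of_forall _ hε.le fun h => by simpa using hg h
  rw [Metric.tendsto_nhds]
  intro ε hε
  have hM : 0 < √(μ.real Set.univ) + 1 := by positivity
  filter_upwards [key2 (ε / (√(μ.real Set.univ) + 1)) (by positivity)] with g hg
  rw [Real.dist_eq, sub_zero, abs_norm]
  refine hg.trans_lt ?_
  rw [div_mul_eq_mul_div, div_lt_iff₀ hM]
  nlinarith

end IndPre

variable [IsTopologicalGroup G] [MeasurableSpace (G ⧸ Γ)] [BorelSpace (G ⧸ Γ)]
  [CompactSpace (G ⧸ Γ)]
  (μ : Measure (G ⧸ Γ)) [IsFiniteMeasure μ] [SMulInvariantMeasure G (G ⧸ Γ) μ]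
  (ρ : Γ →* unitary (V →L[ℂ] V))

/-- The Hilbert space of the induced representation: the `L²` completion of the space of
continuous equivariant functions. -/
abbrev IndSpace : Type _ := UniformSpace.Completion (IndPre Γ μ ρ)

/-- The unitary operator of translation by `g` on `IndSpace`, extending `IndPre.translate`. -/
def indIso (g : G) : IndSpace Γ μ ρ ≃ₗᵢ[ℂ] IndSpace Γ μ ρ where
  toFun := (IndPre.translate Γ μ ρ g).toContinuousLinearMap.completion
  invFun := (IndPre.translate Γ μ ρ g⁻¹).toContinuousLinearMap.completion
  map_add' := map_add _
  map_smul' := map_smul _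
  left_inv v := by
    induction v using UniformSpace.Completion.induction_on with
    | hp => exact isClosed_eq (by fun_prop) continuous_id
    | ih φ => simp [IndPre.translate_translate, IndPre.translate_one]
  right_inv v := by
    induction v using UniformSpace.Completion.induction_on with
    | hp => exact isClosed_eq (by fun_prop) continuous_id
    | ih φ => simp [IndPre.translate_translate, IndPre.translate_one]
  norm_map' v := by
    induction v using UniformSpace.Completion.induction_on with
    | hp => exact isClosed_eq (by dsimp; fun_prop) continuous_norm
    | ih φ => simp

@[simp] theorem indIso_coe (g : G) (φ : IndPre Γ μ ρ) :
    indIso Γ μ ρ g (φ : IndSpace Γ μ ρ) = (IndPre.translate Γ μ ρ g φ : IndPre Γ μ ρ) :=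
  ContinuousLinearMap.completion_apply_coe _ φ

theorem continuous_indIso (v : IndSpace Γ μ ρ) : Continuous fun g => indIso Γ μ ρ g v := by
  rw [Metric.continuous_iff']
  intro g₀ ε hε
  obtain ⟨φ, hφ⟩ : ∃ φ : IndPre Γ μ ρ, dist v (φ : IndSpace Γ μ ρ) < ε / 3 :=
    (UniformSpace.Completion.denseRange_coe).exists_dist_lt v (by positivity)
  have hc : Continuous fun g => ((IndPre.translate Γ μ ρ g φ : IndPre Γ μ ρ) : IndSpace Γ μ ρ) :=
    (UniformSpace.Completion.continuous_coe _).comp (IndPre.continuous_translate φ)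
  filter_upwards [Metric.continuous_iff'.mp hc g₀ (ε / 3) (by positivity)] with g hg
  have h1 : dist (indIso Γ μ ρ g v) (indIso Γ μ ρ g φ) < ε / 3 := by
    rwa [LinearIsometryEquiv.dist_map]
  have h2 : dist (indIso Γ μ ρ g₀ φ) (indIso Γ μ ρ g₀ v) < ε / 3 := by
    rwa [LinearIsometryEquiv.dist_map, dist_comm]
  rw [← indIso_coe, ← indIso_coe] at hg
  have h3 := dist_triangle4 (indIso Γ μ ρ g v) (indIso Γ μ ρ g φ) (indIso Γ μ ρ g₀ φ)
    (indIso Γ μ ρ g₀ v)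
  linarith

/-- The induced representation `Ind_Γ^G ρ` (for `G ⧸ Γ` compact with a finite invariant measure
`μ`), on the `L²` completion of the continuous functions `φ : G → V` with
`φ(gγ) = ρ(γ)⁻¹ φ(g)`, acting by `(π(g)φ)(h) = φ(g⁻¹h)`. -/
def Ind : UnitaryRep G (IndSpace Γ μ ρ) where
  toHom :=
    MonoidHom.comp (Unitary.linearIsometryEquiv (𝕜 := ℂ) (H := IndSpace Γ μ ρ)).symm.toMonoidHom
    { toFun := indIso Γ μ ρ
      map_one' := by
        ext v
        induction v using UniformSpace.Completion.induction_on with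
        | hp => exact isClosed_eq (LinearIsometryEquiv.continuous _) continuous_id
        | ih φ => simp [IndPre.translate_one]
      map_mul' := fun g g' => by
        ext v
        induction v using UniformSpace.Completion.induction_on with
        | hp => exact isClosed_eq (LinearIsometryEquiv.continuous _)
                  (LinearIsometryEquiv.continuous _)
        | ih φ => simp [IndPre.translate_translate] }
  continuous_orbit := continuous_indIso Γ μ ρ

@[simp] theorem Ind_apply_coe (g : G) (φ : IndPre Γ μ ρ) :
    ((Ind Γ μ ρ).toHom g : IndSpace Γ μ ρ →L[ℂ] IndSpace Γ μ ρ) (φ : IndSpace Γ μ ρ)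
      = (IndPre.translate Γ μ ρ g φ : IndPre Γ μ ρ) :=
  indIso_coe Γ μ ρ g φ

end Induced

end StrongInduction

end

/-! The plan is to compare ‖π(F)‖ with the norms of the group algebra elements z_{h,g} = ∑_γ F(hγg)
γ, with h and g in fixed compact sets, at a cost that does not depend on the representation, and
then to remove the cost by taking high powers.

From above (`IndPre.norm_op_le`): unfolding ∫ F(y) φ(y⁻¹h) dν(y) along a Γ-partition of unity turns
π(F) into an integral operator with kernel ρ(z_{h,g}), so ‖π(F)‖ is at most a constant times sup
‖ρ(z_{h,g})‖.

From below (`IndPre.norm_groupAlgebraOp_oddPower_le`): put T = π(f) and let F be the function with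
π(F) = (TT*)^(k+1) T. The vector ρ(z_{h,g})v is the value at h of an equivariant function obtained
from the Γ-average of f(·g) and v by applying T*(TT*)^k and then smearing by f. The last smearing
maps L² to sup norm and the average has L² norm O(‖v‖), so ‖ρ(z_{h,g})‖ ≤ const · ‖T‖^(2k+1), with a
constant independent of k and ρ.

Since ‖π(F)‖ = ‖T‖^(2k+3) by the C*-identity, using one bound for ρ_i and the other for ρ_∞, linked
by ‖ρ_i(z)‖ → ‖ρ_∞(z)‖, compares odd powers of ‖π_i(f)‖ and ‖π_∞(f)‖ up to a fixed factor. Letting k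
grow makes that factor harmless (`tendsto_of_odd_pow_bounds`). -/

noncomputable section

namespace StrongInduction

open scoped Pointwise

/-! ### Convolution and adjoints on `C_c(G)`. -/

section Convolution

variable {G : Type*} [Group G] [TopologicalSpace G] [IsTopologicalGroup G]

/-- The involution `g ↦ conj f(g⁻¹)`. -/
def conjInv (f : C_c(G, ℂ)) : C_c(G, ℂ) where
  toFun x := star (f x⁻¹)
  continuous_toFun := (f.continuous.comp continuous_inv).star
  hasCompactSupport' := by
    have h := f.hasCompactSupport.comp_homeomorph (Homeomorph.inv G)
    exact h.comp_left (g := star) (star_zero ℂ)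

theorem conjInv_apply (f : C_c(G, ℂ)) (x : G) : conjInv f x = star (f x⁻¹) := rfl

/-- The right translate `x ↦ f(x g)`. -/
def rightTranslate (f : C_c(G, ℂ)) (g : G) : C_c(G, ℂ) where
  toFun x := f (x * g)
  continuous_toFun := f.continuous.comp (continuous_mul_const g)
  hasCompactSupport' := f.hasCompactSupport.comp_homeomorph (Homeomorph.mulRight g)

@[simp] theorem rightTranslate_apply (f : C_c(G, ℂ)) (g x : G) :
    rightTranslate f g x = f (x * g) := rfl

variable [MeasurableSpace G] [BorelSpace G]

/-- The smearing `x ↦ ∫ f(y) φ(y⁻¹ x) dσ(y)` of a continuous map by a compactly supported function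
is continuous. -/
theorem continuous_integral_smul_comp_inv_mul {E : Type*} [NormedAddCommGroup E] [NormedSpace ℂ E]
    (σ : Measure G) [IsFiniteMeasureOnCompacts σ] (f : C_c(G, ℂ)) {φ : G → E}
    (hφ : Continuous φ) : Continuous fun x => ∫ y, f y • φ (y⁻¹ * x) ∂σ := by
  rw [← continuousOn_univ]
  refine continuousOn_integral_of_compact_support (k := tsupport f) f.hasCompactSupport
    (Continuous.continuousOn ?_) fun x y _ hy => ?_
  · have := f.continuous
    simp only [Function.uncurry_def]
    fun_prop
  · rw [image_eq_zero_of_notMem_tsupport hy, zero_smul]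

theorem integrable_smul_comp_inv_mul {E : Type*} [NormedAddCommGroup E] [NormedSpace ℂ E]
    (σ : Measure G) [IsFiniteMeasureOnCompacts σ] (f : C_c(G, ℂ)) {φ : G → E}
    (hφ : Continuous φ) (x : G) : Integrable (fun y => f y • φ (y⁻¹ * x)) σ := by
  refine Continuous.integrable_of_hasCompactSupport ?_ f.hasCompactSupport.smul_right
  have := f.continuous
  fun_prop

/-- The convolution `(f * u)(x) = ∫ f(y) u(y⁻¹ x) dσ(y)`, with respect to a measure `σ`. -/
def conv (σ : Measure G) [IsFiniteMeasureOnCompacts σ] (f u : C_c(G, ℂ)) : C_c(G, ℂ) where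
  toFun x := ∫ y, f y • u (y⁻¹ * x) ∂σ
  continuous_toFun := continuous_integral_smul_comp_inv_mul σ f u.continuous
  hasCompactSupport' := by
    refine HasCompactSupport.intro (f.hasCompactSupport.isCompact.mul u.hasCompactSupport.isCompact)
      fun x hx => ?_
    refine integral_eq_zero_of_ae (Eventually.of_forall fun y => ?_)
    by_cases hy : y ∈ tsupport f
    · have : y⁻¹ * x ∉ tsupport u := fun h => hx ⟨y, hy, y⁻¹ * x, h, by simp⟩
      simp [image_eq_zero_of_notMem_tsupport this]
    · simp [image_eq_zero_of_notMem_tsupport hy]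

theorem conv_apply (σ : Measure G) [IsFiniteMeasureOnCompacts σ] (f u : C_c(G, ℂ)) (x : G) :
    conv σ f u x = ∫ y, f y • u (y⁻¹ * x) ∂σ := rfl

theorem conv_rightTranslate (σ : Measure G) [IsFiniteMeasureOnCompacts σ] (f u : C_c(G, ℂ))
    (g : G) : conv σ f (rightTranslate u g) = rightTranslate (conv σ f u) g := by
  ext x
  simp [conv_apply, mul_assoc]

variable {H : Type*} [NormedAddCommGroup H] [InnerProductSpace ℂ H] [CompleteSpace H]

omit [IsTopologicalGroup G] in
theorem UnitaryRep.op_apply (σ : Measure G) [IsFiniteMeasureOnCompacts σ] (π : UnitaryRep G H)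
    (f : C_c(G, ℂ)) (v : H) : π.op σ f v = ∫ g, f g • (π.toHom g : H →L[ℂ] H) v ∂σ := rfl

/-- Fubini followed by x ↦ yx. Only the inner measure is translated, so `σ` can be arbitrary; this
allows `ν` and `ν.inv` to be mixed below. -/
theorem UnitaryRep.op_conv (σ ν : Measure G) [IsFiniteMeasureOnCompacts σ]
    [IsFiniteMeasureOnCompacts ν] [ν.IsMulLeftInvariant] (π : UnitaryRep G H) (f u : C_c(G, ℂ)) :
    π.op ν (conv σ f u) = π.op σ f * π.op ν u := by
  ext v
  rw [mul_apply_eq_comp, op_apply, op_apply, op_apply]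
  have hf := f.continuous
  have hu := u.continuous
  have hπ := π.continuous_orbit v
  calc ∫ x, conv σ f u x • (π.toHom x : H →L[ℂ] H) v ∂ν
      = ∫ x, ∫ y, (f y • u (y⁻¹ * x)) • (π.toHom x : H →L[ℂ] H) v ∂σ ∂ν := by
        congr 1 with x
        rw [integral_smul_const, conv_apply]
    _ = ∫ y, ∫ x, (f y • u (y⁻¹ * x)) • (π.toHom x : H →L[ℂ] H) v ∂ν ∂σ := by
        refine integral_integral_swap_of_hasCompactSupport ?_ ?_
        · have hπ' : Continuous fun z : G × G => (π.toHom z.1 : H →L[ℂ] H) v :=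
            hπ.comp continuous_fst
          simp only [Function.uncurry_def]
          fun_prop
        · refine HasCompactSupport.intro ((f.hasCompactSupport.isCompact.mul
            u.hasCompactSupport.isCompact).prod f.hasCompactSupport.isCompact) fun z hz => ?_
          simp only [Function.uncurry_def]
          by_cases hy : z.2 ∈ tsupport f
          · have : z.2⁻¹ * z.1 ∉ tsupport u := fun h =>
              hz ⟨⟨z.2, hy, z.2⁻¹ * z.1, h, by simp⟩, hy⟩
            simp [image_eq_zero_of_notMem_tsupport this]
          · simp [image_eq_zero_of_notMem_tsupport hy]
    _ = ∫ y, f y • (π.toHom y : H →L[ℂ] H) (∫ x, u x • (π.toHom x : H →L[ℂ] H) v ∂ν) ∂σ := by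
        congr 1 with y
        rw [← integral_mul_left_eq_self _ y,
          ← ContinuousLinearMap.integral_comp_comm _ (π.integrable_smul ν u v), ← integral_smul]
        congr 1 with x
        simp [smul_smul]

/-- Integrating the adjoint against `ν.inv` replaces any modular function, so unimodularity never
has to be proved. -/
theorem UnitaryRep.adjoint_op (ν : Measure G) [IsFiniteMeasureOnCompacts ν] (π : UnitaryRep G H)
    (f : C_c(G, ℂ)) : star (π.op ν f) = π.op ν.inv (conjInv f) := by
  rw [ContinuousLinearMap.star_eq_adjoint]
  symm
  rw [ContinuousLinearMap.eq_adjoint_iff]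
  intro x y
  have hc : Continuous fun g => conjInv f g • (π.toHom g : H →L[ℂ] H) x :=
    (conjInv f).continuous.smul (π.continuous_orbit x)
  have e : ∫ g, conjInv f g • (π.toHom g : H →L[ℂ] H) x ∂ν.inv =
      ∫ g, conjInv f g⁻¹ • (π.toHom g⁻¹ : H →L[ℂ] H) x ∂ν :=
    (Homeomorph.inv G).measurableEmbedding.integral_map
      (fun g => conjInv f g • (π.toHom g : H →L[ℂ] H) x)
  rw [op_apply, op_apply, e]
  have h1 : Integrable (fun g => conjInv f g⁻¹ • (π.toHom g⁻¹ : H →L[ℂ] H) x) ν := by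
    refine (hc.comp continuous_inv).integrable_of_hasCompactSupport ?_
    exact ((conjInv f).hasCompactSupport.smul_right (f' := fun g =>
      (π.toHom g : H →L[ℂ] H) x)).comp_homeomorph (Homeomorph.inv G)
  rw [← integral_inner (π.integrable_smul ν f y), ← inner_conj_symm]
  rw [← integral_inner h1, ← integral_conj]
  congr 1 with g
  rw [inner_conj_symm, inner_smul_left, inner_smul_right, conjInv_apply]
  simp only [inv_inv, RCLike.star_def, Complex.conj_conj, map_inv]
  congr 1
  rw [← Unitary.inner_map_map (π.toHom g), ← mul_apply_eq_comp, ← Submonoid.coe_mul]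
  simp

end Convolution

/-! ### Compact representatives and integration over G/Γ. -/

section Quotient

variable {G : Type*} [Group G] [TopologicalSpace G] [IsTopologicalGroup G]

theorem exists_isCompact_forall_mul_mem [LocallyCompactSpace G] (Γ : Subgroup G)
    [CompactSpace (G ⧸ Γ)] : ∃ K : Set G, IsCompact K ∧ ∀ g : G, ∃ γ : Γ, g * γ ∈ K := by
  choose N hN hN' using fun g : G => exists_compact_mem_nhds g
  have hU : ∀ x ∈ (Set.univ : Set (G ⧸ Γ)), ((↑) : G → G ⧸ Γ) '' N x.out ∈ 𝓝 x := fun x _ => by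
    have := QuotientGroup.isOpenMap_coe.image_mem_nhds (hN' x.out) (f := ((↑) : G → G ⧸ Γ))
    rwa [QuotientGroup.out_eq'] at this
  obtain ⟨t, -, ht⟩ := isCompact_univ.elim_nhds_subcover _ hU
  refine ⟨⋃ x ∈ t, N x.out, t.isCompact_biUnion fun x _ => hN _, fun g => ?_⟩
  obtain ⟨x, hx, k, hk, hkg⟩ := Set.mem_iUnion₂.mp (ht (Set.mem_univ (g : G ⧸ Γ)))
  refine ⟨⟨g⁻¹ * k, QuotientGroup.eq.mp hkg.symm⟩, Set.mem_iUnion₂.mpr ⟨x, hx, ?_⟩⟩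
  simpa using hk

variable [LocallyCompactSpace G] [MeasurableSpace G] [BorelSpace G]
  (ν : Measure G) [IsFiniteMeasureOnCompacts ν] [ν.IsMulLeftInvariant]
  (Γ : Subgroup G) [CompactSpace (G ⧸ Γ)] [MeasurableSpace (G ⧸ Γ)] [BorelSpace (G ⧸ Γ)]
  (μ : Measure (G ⧸ Γ)) [SMulInvariantMeasure G (G ⧸ Γ) μ] [IsFiniteMeasure μ] [NeZero μ]

/-- Integrating a nonnegative function on `G ⧸ Γ` over (the inverse of) a compact piece of `G` is
controlled by its integral over `G ⧸ Γ`. -/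
theorem exists_setIntegral_inv_le {Q : Set G} (hQ : IsCompact Q) :
    ∃ C : ℝ, 0 ≤ C ∧ ∀ (p : G ⧸ Γ → ℝ), Continuous p → 0 ≤ p → ∀ q : G → ℝ, Continuous q →
      (∀ a, q a ≤ 1) → (∀ a ∉ Q, q a = 0) →
      ∫ a, q a * p ((a⁻¹ : G) : G ⧸ Γ) ∂ν ≤ C * ∫ x, p x ∂μ := by
  obtain ⟨K, hK, hKΓ⟩ := exists_isCompact_forall_mul_mem Γ
  obtain ⟨η, hη1, -, hηc, hη⟩ := exists_continuous_one_zero_of_isCompact (hK.mul hQ)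
    isClosed_empty (Set.disjoint_empty _)
  have hM : 0 < μ.real Set.univ := by simp [measureReal_def, ENNReal.toReal_pos_iff, NeZero.ne μ]
  -- The left side is bounded by ∫ η(a) p(a⁻¹x) dν(a) for every x. Averaging over x with the
  -- invariant measure μ gives (∫ η)(∫ p)/μ(G/Γ), without any formula relating ν to μ.
  refine ⟨(∫ a, η a ∂ν) / μ.real Set.univ, div_nonneg (integral_nonneg fun a => (hη a).1) hM.le,
    fun p hp hp0 q hq hq1 hqQ => ?_⟩
  have hpi : ∀ x : G ⧸ Γ, Integrable (fun a => η a * p (a⁻¹ • x)) ν := fun x => by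
    refine Continuous.integrable_of_hasCompactSupport ?_ hηc.mul_right
    fun_prop
  have key : ∀ x : G ⧸ Γ,
      ∫ a, q a * p ((a⁻¹ : G) : G ⧸ Γ) ∂ν ≤ ∫ a, η a * p (a⁻¹ • x) ∂ν := fun x => by
    induction x using QuotientGroup.induction_on with
    | H g =>
      obtain ⟨γ, hγ⟩ := hKΓ g
      have hx : ((g * γ : G) : G ⧸ Γ) = g := by simp
      rw [← hx]
      set h := g * γ
      -- With x = hΓ and h ∈ K, the change a ↦ ha turns a⁻¹x into a⁻¹Γ, and η(ha) = 1 for a ∈ Q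
      -- because η = 1 on KQ.
      rw [← integral_mul_left_eq_self (fun a => η a * p (a⁻¹ • (h : G ⧸ Γ))) h]
      refine integral_mono ?_ ((hpi h).comp_mul_left h) fun a => ?_
      · refine Continuous.integrable_of_hasCompactSupport (by fun_prop) ?_
        exact (HasCompactSupport.intro hQ hqQ).mul_right
      · have e : (h * a)⁻¹ • (h : G ⧸ Γ) = ((a⁻¹ : G) : G ⧸ Γ) := by
          rw [MulAction.Quotient.smul_coe]; simp
        simp only [e]
        refine mul_le_mul_of_nonneg_right ?_ (hp0 _)
        by_cases ha : a ∈ Q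
        · rw [hη1 (Set.mul_mem_mul hγ ha)]; exact hq1 a
        · rw [hqQ a ha]; exact (hη _).1
  have swap : ∫ x, ∫ a, η a * p (a⁻¹ • x) ∂ν ∂μ = (∫ a, η a ∂ν) * ∫ x, p x ∂μ := by
    rw [integral_integral_swap_of_hasCompactSupport]
    · simp_rw [integral_const_mul, integral_smul_eq_self, integral_mul_const]
    · simp only [Function.uncurry_def]
      fun_prop
    · refine (isCompact_univ.prod hηc.isCompact).of_isClosed_subset (isClosed_tsupport _)
        (closure_minimal (fun z hz => ⟨Set.mem_univ _, ?_⟩)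
          (isClosed_univ.prod (isClosed_tsupport _)))
      by_contra h
      exact hz (by simp [Function.uncurry_def, image_eq_zero_of_notMem_tsupport h])
  have hint : Integrable (fun x => ∫ a, η a * p (a⁻¹ • x) ∂ν) μ := by
    refine Continuous.integrable_of_hasCompactSupport ?_ (HasCompactSupport.of_compactSpace _)
    rw [← continuousOn_univ]
    refine continuousOn_integral_of_compact_support (k := tsupport η) hηc
      (Continuous.continuousOn ?_) fun x y _ hy => ?_
    · simp only [Function.uncurry_def]
      fun_prop
    · rw [image_eq_zero_of_notMem_tsupport hy, zero_mul]
  have h1 := integral_mono (integrable_const (μ := μ) _) hint key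
  rw [integral_const, swap, smul_eq_mul] at h1
  rw [div_mul_eq_mul_div, le_div_iff₀ hM, mul_comm]
  exact h1

end Quotient

/-! ### Smearing of equivariant functions. -/

namespace IndPre

variable {G : Type*} [Group G] [TopologicalSpace G] [IsTopologicalGroup G] [MeasurableSpace G]
  [BorelSpace G] {Γ : Subgroup G} [CompactSpace (G ⧸ Γ)] [MeasurableSpace (G ⧸ Γ)]
  [BorelSpace (G ⧸ Γ)] {μ : Measure (G ⧸ Γ)} [IsFiniteMeasure μ]
  {V : Type*} [NormedAddCommGroup V] [InnerProductSpace ℂ V] [CompleteSpace V]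
  {ρ : Γ →* unitary (V →L[ℂ] V)}

/-- The function `gΓ ↦ ‖φ(g)‖` on `G ⧸ Γ`. -/
def fiberNorm (φ : IndPre Γ μ ρ) (x : G ⧸ Γ) : ℝ := √(fiberInner φ φ x).re

omit [IsTopologicalGroup G] [MeasurableSpace G] [BorelSpace G] [CompactSpace (G ⧸ Γ)]
  [BorelSpace (G ⧸ Γ)] [IsFiniteMeasure μ] in
@[simp] theorem fiberNorm_mk (φ : IndPre Γ μ ρ) (g : G) :
    fiberNorm φ (g : G ⧸ Γ) = ‖φ.toMap g‖ := by
  rw [fiberNorm, fiberInner_mk, norm_eq_sqrt_re_inner (𝕜 := ℂ)]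
  rfl

omit [IsTopologicalGroup G] [MeasurableSpace G] [BorelSpace G] [CompactSpace (G ⧸ Γ)]
  [BorelSpace (G ⧸ Γ)] [IsFiniteMeasure μ] in
theorem continuous_fiberNorm (φ : IndPre Γ μ ρ) : Continuous (fiberNorm φ) :=
  (Complex.continuous_re.comp (continuous_fiberInner φ φ)).sqrt

-- Cauchy–Schwarz against the constant 1, obtained from the discriminant of t ↦ ∫ (‖φ‖ - t)² dμ ≥ 0.
omit [IsTopologicalGroup G] [MeasurableSpace G] [BorelSpace G] in
theorem integral_fiberNorm_le (φ : IndPre Γ μ ρ) :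
    ∫ x, fiberNorm φ x ∂μ ≤ √(μ.real Set.univ) * ‖φ‖ := by
  have hi : ∀ {p : G ⧸ Γ → ℝ}, Continuous p → Integrable p μ := fun hp =>
    hp.integrable_of_hasCompactSupport (HasCompactSupport.of_compactSpace _)
  have hc := continuous_fiberNorm φ
  set I := ∫ x, fiberNorm φ x ∂μ
  set M := μ.real Set.univ
  have hsq : ∫ x, fiberNorm φ x ^ 2 ∂μ = ‖φ‖ ^ 2 := by
    have h1 : ∀ x, fiberNorm φ x ^ 2 = RCLike.re (fiberInner φ φ x) := fun x => by
      induction x using QuotientGroup.induction_on with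
      | H g => rw [fiberNorm_mk, fiberInner_mk, inner_self_eq_norm_sq]
    simp_rw [h1]
    rw [integral_re (integrable_fiberInner φ φ), ← inner_def, inner_self_eq_norm_sq]
  have hquad : ∀ t : ℝ, 0 ≤ M * (t * t) + (-2 * I) * t + ‖φ‖ ^ 2 := fun t => by
    have h0 : 0 ≤ ∫ x, (fiberNorm φ x - t) ^ 2 ∂μ := integral_nonneg fun x => sq_nonneg _
    have h1 : ∀ x, (fiberNorm φ x - t) ^ 2 =
        fiberNorm φ x ^ 2 + ((-2 * t) * fiberNorm φ x + t * t) :=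
      fun x => by ring
    simp_rw [h1] at h0
    rw [integral_add (hi (by fun_prop)) (hi (by fun_prop)), hsq,
      integral_add (hi (by fun_prop)) (hi (by fun_prop)), integral_const_mul, integral_const,
      smul_eq_mul] at h0
    linarith
  have hd := discrim_le_zero hquad
  rw [discrim] at hd
  have hM : 0 ≤ M := measureReal_nonneg
  refine abs_le_of_sq_le_sq' ?_ (by positivity) |>.2
  rw [mul_pow, Real.sq_sqrt hM]
  linarith

/-- Smearing of an equivariant function: `h ↦ ∫ f(y) φ(y⁻¹ h) dσ(y)`. -/
def smear (σ : Measure G) [IsFiniteMeasureOnCompacts σ] (f : C_c(G, ℂ)) (φ : IndPre Γ μ ρ) :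
    IndPre Γ μ ρ :=
  mk ⟨fun h => ∫ y, f y • φ.toMap (y⁻¹ * h) ∂σ,
    continuous_integral_smul_comp_inv_mul σ f φ.toMap.continuous⟩ fun h γ => by
      simp only [ContinuousMap.coe_mk]
      rw [← ContinuousLinearMap.integral_comp_comm _
        (integrable_smul_comp_inv_mul σ f φ.toMap.continuous h)]
      congr 1 with y
      rw [map_smul, ← mul_assoc, toMap_mul]

omit [CompactSpace (G ⧸ Γ)] [BorelSpace (G ⧸ Γ)] [IsFiniteMeasure μ] in
theorem smear_toMap (σ : Measure G) [IsFiniteMeasureOnCompacts σ] (f : C_c(G, ℂ))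
    (φ : IndPre Γ μ ρ) (h : G) :
    (smear σ f φ).toMap h = ∫ y, f y • φ.toMap (y⁻¹ * h) ∂σ := rfl

variable [SMulInvariantMeasure G (G ⧸ Γ) μ]

/-- The Hilbert-space-valued integral is identified with the pointwise one by pairing with the dense
set of continuous equivariant functions and exchanging the integrals over G and G/Γ. -/
theorem op_coe (σ : Measure G) [IsFiniteMeasureOnCompacts σ] (f : C_c(G, ℂ)) (φ : IndPre Γ μ ρ) :
    (Ind Γ μ ρ).op σ f (φ : IndSpace Γ μ ρ) = (smear σ f φ : IndPre Γ μ ρ) := by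
  refine ext_inner_left ℂ fun w => ?_
  induction w using UniformSpace.Completion.induction_on with
  | hp => exact isClosed_eq (by fun_prop) (by fun_prop)
  | ih ψ =>
    rw [UnitaryRep.op_apply, ← integral_inner (UnitaryRep.integrable_smul σ _ f _),
      UniformSpace.Completion.inner_coe, inner_def]
    have h1 : ∀ x, fiberInner ψ (smear σ f φ) x =
        ∫ y, f y • fiberInner ψ (translate Γ μ ρ y φ) x ∂σ := fun x => by
      induction x using QuotientGroup.induction_on with
      | H g =>
        rw [fiberInner_mk, smear_toMap,
          ← integral_inner (integrable_smul_comp_inv_mul σ f φ.toMap.continuous g)]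
        congr 1 with y
        rw [inner_smul_right, fiberInner_mk, translate_toMap, smul_eq_mul]
    simp_rw [h1]
    rw [← integral_integral_swap_of_hasCompactSupport]
    · congr 1 with y
      rw [integral_smul, ← inner_def, Ind_apply_coe, inner_smul_right,
        UniformSpace.Completion.inner_coe, smul_eq_mul]
    · have hq : IsOpenQuotientMap (Prod.map id ((↑) : G → G ⧸ Γ) : G × G → G × (G ⧸ Γ)) :=
        IsOpenQuotientMap.id.prodMap QuotientGroup.isOpenQuotientMap_mk
      -- Joint continuity on G × G/Γ is checked after pulling back along the open quotient map from
      -- G × G.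
      refine hq.isQuotientMap.continuous_iff.mpr ?_
      have e : (Function.uncurry fun y x => f y • fiberInner ψ (translate Γ μ ρ y φ) x) ∘
          Prod.map id ((↑) : G → G ⧸ Γ) =
          fun z : G × G => f z.1 * inner ℂ (ψ.toMap z.2) (φ.toMap (z.1⁻¹ * z.2)) := by
        ext z
        simp [Function.uncurry_def]
      rw [e]
      have := f.continuous
      fun_prop
    · refine (f.hasCompactSupport.isCompact.prod isCompact_univ).of_isClosed_subset
        (isClosed_tsupport _) (closure_minimal (fun z hz => ⟨?_, Set.mem_univ _⟩)
          ((isClosed_tsupport _).prod isClosed_univ))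
      by_contra h
      exact hz (by simp [Function.uncurry_def, image_eq_zero_of_notMem_tsupport h])

end IndPre

/-! ### Finiteness from discreteness, and a partition of unity. -/

section Discrete

variable {G : Type*} [Group G] [TopologicalSpace G] [IsTopologicalGroup G] [T2Space G]
  (Γ : Subgroup G) [DiscreteTopology Γ]

theorem finite_coe_mem_of_isCompact {Q : Set G} (hQ : IsCompact Q) :
    {γ : Γ | (γ : G) ∈ Q}.Finite := by
  have h := Γ.tendsto_coe_cofinite_of_discrete (isDiscrete_iff_discreteTopology.mpr inferInstance)
    hQ.compl_mem_cocompact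
  rw [mem_map, mem_cofinite] at h
  exact h.subset fun γ hγ h' => h' hγ

/-- If hγg ∈ Q then γ lies in the compact set K⁻¹QL⁻¹, which meets Γ in a finite set. One finite set
thus serves all h ∈ K, g ∈ L. -/
theorem exists_finset_mul_mul_notMem {K Q L : Set G} (hK : IsCompact K) (hQ : IsCompact Q)
    (hL : IsCompact L) : ∃ S : Finset Γ, ∀ h ∈ K, ∀ g ∈ L, ∀ γ : Γ, γ ∉ S → h * γ * g ∉ Q := by
  refine ⟨(finite_coe_mem_of_isCompact Γ ((hK.inv.mul hQ).mul hL.inv)).toFinset,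
    fun h hh g hg γ hγ hQ' => hγ ?_⟩
  rw [Set.Finite.mem_toFinset]
  exact ⟨h⁻¹ * (h * γ * g), ⟨h⁻¹, Set.inv_mem_inv.mpr hh, _, hQ', rfl⟩, g⁻¹,
    Set.inv_mem_inv.mpr hg, by group⟩

theorem finite_support_comp_mul {E : Type*} [Zero E] {u : G → E} (hu : HasCompactSupport u)
    (h : G) : (Function.support fun γ : Γ => u (h * γ)).Finite := by
  obtain ⟨S, hS⟩ := exists_finset_mul_mul_notMem Γ (isCompact_singleton (x := h)) hu.isCompact
    (isCompact_singleton (x := (1 : G)))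
  refine S.finite_toSet.subset fun γ hγ => ?_
  by_contra hγS
  refine hγ (image_eq_zero_of_notMem_tsupport ?_)
  simpa using hS h rfl 1 rfl γ hγS

theorem locallyFinite_support_comp_mul [LocallyCompactSpace G] {E : Type*} [Zero E] {u : G → E}
    (hu : HasCompactSupport u) :
    LocallyFinite fun γ : Γ => Function.support fun h : G => u (h * γ) := by
  intro x
  obtain ⟨N, hN, hNx⟩ := exists_compact_mem_nhds x
  obtain ⟨S, hS⟩ := exists_finset_mul_mul_notMem Γ hN hu.isCompact
    (isCompact_singleton (x := (1 : G)))
  refine ⟨N, hNx, S.finite_toSet.subset ?_⟩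
  rintro γ ⟨h, hh, hhN⟩
  by_contra hγS
  refine hh (image_eq_zero_of_notMem_tsupport ?_)
  simpa using hS h hhN 1 rfl γ hγS

/-- A partition of unity on `G` whose members are the `Γ`-translates of one function. -/
theorem exists_partition_of_unity [LocallyCompactSpace G] [CompactSpace (G ⧸ Γ)] :
    ∃ w : G → ℝ, Continuous w ∧ HasCompactSupport w ∧ (∀ g, 0 ≤ w g) ∧ (∀ g, w g ≤ 1) ∧
      ∀ g, ∑ᶠ γ : Γ, w (g * γ) = 1 := by
  obtain ⟨K, hK, hKΓ⟩ := exists_isCompact_forall_mul_mem Γ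
  obtain ⟨η, hη1, -, hηc, hη⟩ := exists_continuous_one_zero_of_isCompact hK
    isClosed_empty (Set.disjoint_empty _)
  have hη0 : ∀ g, 0 ≤ η g := fun g => (hη g).1
  -- The Γ-periodization of η: it is positive since every coset meets K, and Γ-invariant, so
  -- dividing η by it gives the partition.
  set s : G → ℝ := fun g => ∑ᶠ γ : Γ, η (g * γ)
  have hs : Continuous s := continuous_finsum (fun γ => by fun_prop)
    (locallyFinite_support_comp_mul Γ hηc)
  have hle : ∀ g, ∀ γ : Γ, η (g * γ) ≤ s g := fun g γ =>
    single_le_finsum γ (finite_support_comp_mul Γ hηc g) fun _ => hη0 _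
  have hpos : ∀ g, 0 < s g := fun g => by
    obtain ⟨γ, hγ⟩ := hKΓ g
    have h1 := hle g γ
    rw [hη1 hγ] at h1
    exact one_pos.trans_le h1
  have hsΓ : ∀ g, ∀ γ : Γ, s (g * γ) = s g := fun g γ => by
    simp only [s]
    rw [← finsum_comp_equiv (Equiv.mulLeft γ) (f := fun γ' : Γ => η (g * γ'))]
    simp [mul_assoc]
  refine ⟨fun g => η g * (s g)⁻¹, η.continuous.mul (hs.inv₀ fun g => (hpos g).ne'), hηc.mul_right,
    fun g => mul_nonneg (hη0 g) (inv_nonneg.mpr (hpos g).le), fun g => ?_, fun g => ?_⟩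
  · beta_reduce
    rw [← div_eq_mul_inv, div_le_one (hpos g)]
    simpa using hle g 1
  · simp_rw [hsΓ]
    rw [← finsum_mul' _ _ (finite_support_comp_mul Γ hηc g)]
    exact mul_inv_cancel₀ (hpos g).ne'

end Discrete

/-! ### The group algebra elements ∑ F(hγg) γ. -/

section GroupAlgebra

variable {G : Type*} [Group G] {Γ : Subgroup G}

/-- The element `∑_{γ ∈ S} F(h γ g) γ` of the group algebra. -/
def translateSum (S : Finset Γ) (F : G → ℂ) (h g : G) : MonoidAlgebra ℂ Γ :=
  ∑ γ ∈ S, MonoidAlgebra.single γ (F (h * γ * g))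

variable {V : Type*} [NormedAddCommGroup V] [InnerProductSpace ℂ V] [CompleteSpace V]
  (ρ : Γ →* unitary (V →L[ℂ] V))

theorem groupAlgebraOp_translateSum (S : Finset Γ) (F : G → ℂ) (h g : G) (v : V) :
    groupAlgebraOp ρ (translateSum S F h g) v =
      ∑ γ ∈ S, F (h * γ * g) • (ρ γ : V →L[ℂ] V) v := by
  rw [groupAlgebraOp, translateSum, map_sum, sum_apply]
  refine Finset.sum_congr rfl fun γ _ => ?_
  rw [MonoidAlgebra.lift_single]
  rfl

theorem norm_groupAlgebraOp_translateSum_le (S : Finset Γ) (F : G → ℂ) (h g : G) :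
    ‖groupAlgebraOp ρ (translateSum S F h g)‖ ≤ ∑ γ ∈ S, ‖F (h * γ * g)‖ := by
  refine ContinuousLinearMap.opNorm_le_bound _ (Finset.sum_nonneg fun _ _ => norm_nonneg _)
    fun v => ?_
  rw [groupAlgebraOp_translateSum, Finset.sum_mul]
  refine norm_sum_le_of_le _ fun γ _ => ?_
  rw [norm_smul, Unitary.norm_map]

end GroupAlgebra

/-! ### Equivariant functions obtained by averaging over Γ. -/

namespace IndPre

variable {G : Type*} [Group G] [TopologicalSpace G] [IsTopologicalGroup G] [T2Space G]
  [LocallyCompactSpace G] {Γ : Subgroup G} [DiscreteTopology Γ] [MeasurableSpace (G ⧸ Γ)]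
  {μ : Measure (G ⧸ Γ)}
  {V : Type*} [NormedAddCommGroup V] [InnerProductSpace ℂ V] [CompleteSpace V]
  {ρ : Γ →* unitary (V →L[ℂ] V)}

variable (μ ρ) in
/-- The equivariant function `h ↦ ∑_γ u(h γ) ρ(γ) v`. -/
def avg (u : C_c(G, ℂ)) (v : V) : IndPre Γ μ ρ :=
  mk ⟨fun h => ∑ᶠ γ : Γ, u (h * γ) • (ρ γ : V →L[ℂ] V) v, by
      refine continuous_finsum (fun γ => ?_)
        ((locallyFinite_support_comp_mul Γ u.hasCompactSupport).subset fun γ h hh h0 => ?_)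
      · have := u.continuous
        fun_prop
      · exact hh (by simp only [h0, zero_smul])⟩ fun g γ => by
      have hfin : (Function.support fun γ' : Γ => u (g * γ') • (ρ γ' : V →L[ℂ] V) v).Finite :=
        (finite_support_comp_mul Γ u.hasCompactSupport g).subset fun γ' hh h0 =>
          hh (by simp only [h0, zero_smul])
      simp only [ContinuousMap.coe_mk]
      rw [← finsum_comp_equiv (Equiv.mulLeft γ⁻¹), map_finsum _ hfin]
      refine finsum_congr fun γ' => ?_
      simp [mul_assoc]

theorem avg_toMap (u : C_c(G, ℂ)) (v : V) (h : G) :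
    (avg μ ρ u v).toMap h = ∑ᶠ γ : Γ, u (h * γ) • (ρ γ : V →L[ℂ] V) v := rfl

theorem avg_toMap_eq_sum (u : C_c(G, ℂ)) (v : V) (h : G) {S : Finset Γ}
    (hS : ∀ γ : Γ, γ ∉ S → u (h * γ) = 0) :
    (avg μ ρ u v).toMap h = ∑ γ ∈ S, u (h * γ) • (ρ γ : V →L[ℂ] V) v := by
  rw [avg_toMap]
  refine finsum_eq_sum_of_support_subset _ fun γ hγ => ?_
  by_contra h0
  exact hγ (by simp only [hS γ h0, zero_smul])

theorem avg_rightTranslate_toMap (F : C_c(G, ℂ)) (v : V) (h g : G) {S : Finset Γ}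
    (hS : ∀ γ : Γ, γ ∉ S → F (h * γ * g) = 0) :
    (avg μ ρ (rightTranslate F g) v).toMap h = groupAlgebraOp ρ (translateSum S F h g) v := by
  rw [avg_toMap_eq_sum _ _ _ hS, groupAlgebraOp_translateSum]
  rfl

/-- Smearing acts on the left of G and averaging on the right, so they commute; the work lies in
finding one finite set of γ valid for all y in the support of f. -/
theorem smear_avg [MeasurableSpace G] [BorelSpace G] (σ : Measure G) [IsFiniteMeasureOnCompacts σ]
    (f u : C_c(G, ℂ)) (v : V) :
    smear σ f (avg μ ρ u v) = avg μ ρ (conv σ f u) v := by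
  refine ext fun h => ?_
  obtain ⟨S, hS⟩ := exists_finset_mul_mul_notMem Γ
    (f.hasCompactSupport.isCompact.inv.mul (isCompact_singleton (x := h)))
    u.hasCompactSupport.isCompact (isCompact_singleton (x := (1 : G)))
  have hS' : ∀ y, ∀ γ : Γ, γ ∉ S → f y = 0 ∨ u (y⁻¹ * h * γ) = 0 := fun y γ hγ => by
    by_cases hy : y ∈ tsupport f
    · refine .inr (image_eq_zero_of_notMem_tsupport ?_)
      simpa using hS (y⁻¹ * h) ⟨y⁻¹, Set.inv_mem_inv.mpr hy, h, rfl, rfl⟩ 1 rfl γ hγ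
    · exact .inl (image_eq_zero_of_notMem_tsupport hy)
  have h1 : ∀ y, f y • (avg μ ρ u v).toMap (y⁻¹ * h) =
      ∑ γ ∈ S, (f y • u (y⁻¹ * (h * γ))) • (ρ γ : V →L[ℂ] V) v := fun y => by
    by_cases hy : f y = 0
    · simp [hy]
    · rw [avg_toMap_eq_sum _ _ _ fun γ hγ => (hS' y γ hγ).resolve_left hy, Finset.smul_sum]
      simp only [smul_smul, smul_eq_mul, mul_assoc]
  rw [smear_toMap, avg_toMap_eq_sum (S := S)]
  · simp_rw [h1]
    rw [integral_finsetSum]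
    · refine Finset.sum_congr rfl fun γ _ => ?_
      rw [integral_smul_const, conv_apply]
    · exact fun γ _ => (integrable_smul_comp_inv_mul σ f u.continuous _).smul_const _
  · intro γ hγ
    rw [conv_apply]
    refine integral_eq_zero_of_ae (Eventually.of_forall fun y => ?_)
    rcases hS' y γ hγ with h0 | h0
    · simp [h0]
    · simp only [← mul_assoc, h0, smul_zero, Pi.zero_apply]

omit [IsTopologicalGroup G] [T2Space G] [LocallyCompactSpace G] [DiscreteTopology Γ] in
theorem norm_toMap_mul (φ : IndPre Γ μ ρ) (g : G) (γ : Γ) : ‖φ.toMap (g * γ)‖ = ‖φ.toMap g‖ := by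
  rw [toMap_mul, Unitary.norm_map]

variable [CompactSpace (G ⧸ Γ)] [BorelSpace (G ⧸ Γ)] [IsFiniteMeasure μ]

omit [IsTopologicalGroup G] [T2Space G] [LocallyCompactSpace G] [DiscreteTopology Γ] in
theorem norm_le_of_forall_mem {K : Set G} (hKΓ : ∀ g : G, ∃ γ : Γ, g * γ ∈ K)
    (φ : IndPre Γ μ ρ) {C : ℝ} (hC : 0 ≤ C) (h : ∀ g ∈ K, ‖φ.toMap g‖ ≤ C) :
    ‖φ‖ ≤ C * √(μ.real Set.univ) := by
  refine norm_le_of_forall φ hC fun g => ?_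
  obtain ⟨γ, hγ⟩ := hKΓ g
  rw [← norm_toMap_mul φ g γ]
  exact h _ hγ

/-- Each value is at most |S| M ‖v‖ because ρ is unitary. The bound does not see ρ, hence is uniform
along the sequence. -/
theorem norm_avg_le {K : Set G} (hKΓ : ∀ g : G, ∃ γ : Γ, g * γ ∈ K) {f : C_c(G, ℂ)} {M : ℝ}
    (hM : ∀ x, ‖f x‖ ≤ M) {S : Finset Γ} {g : G}
    (hS : ∀ h ∈ K, ∀ γ : Γ, γ ∉ S → f (h * γ * g) = 0) (v : V) :
    ‖avg μ ρ (rightTranslate f g) v‖ ≤ S.card * M * √(μ.real Set.univ) * ‖v‖ := by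
  have hM0 : 0 ≤ M := (norm_nonneg _).trans (hM 1)
  rw [mul_right_comm]
  refine norm_le_of_forall_mem hKΓ _ (by positivity) fun h hh => ?_
  rw [avg_rightTranslate_toMap f v h g (hS h hh)]
  refine ContinuousLinearMap.le_of_opNorm_le _ ?_ v
  refine (norm_groupAlgebraOp_translateSum_le ρ S f h g).trans ?_
  simpa using Finset.sum_le_card_nsmul S _ M fun γ _ => hM (h * γ * g)

end IndPre

/-! ### C*-norms of odd powers, and the limiting argument. -/

section CStar

variable {A : Type*} [NormedRing A] [StarRing A] [CStarRing A]

theorem norm_pow_of_isSelfAdjoint {x : A} (hx : IsSelfAdjoint x) {n : ℕ} (hn : n ≠ 0) :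
    ‖x ^ n‖ = ‖x‖ ^ n := by
  refine le_antisymm (norm_pow_le' x (Nat.pos_of_ne_zero hn)) ?_
  rcases eq_or_ne x 0 with rfl | h0
  · simp [hn]
  have hpos : 0 < ‖x‖ := norm_pos_iff.mpr h0
  obtain hlt : n < 2 ^ n := Nat.lt_two_pow_self
  -- The equality is known for the exponent 2^n > n; splitting x^(2^n) = x^n x^(2^n - n) and
  -- cancelling ‖x‖^(2^n - n) gives it for n.
  have h1 : ‖x‖ ^ (2 ^ n) ≤ ‖x ^ n‖ * ‖x‖ ^ (2 ^ n - n) := by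
    rw [← hx.norm_pow_two_pow n]
    nth_rewrite 1 [← Nat.add_sub_of_le hlt.le]
    rw [pow_add]
    exact (norm_mul_le _ _).trans
      (mul_le_mul_of_nonneg_left (norm_pow_le' x (Nat.sub_pos_of_lt hlt)) (norm_nonneg _))
  nth_rewrite 1 [← Nat.add_sub_of_le hlt.le] at h1
  rw [pow_add] at h1
  exact le_of_mul_le_mul_right h1 (by positivity)

theorem norm_mul_star_pow_mul (x : A) (k : ℕ) : ‖(x * star x) ^ k * x‖ = ‖x‖ ^ (2 * k + 1) := by
  have hs : IsSelfAdjoint (x * star x) := IsSelfAdjoint.mul_star_self x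
  have h1 : ‖(x * star x) ^ k * x‖ ^ 2 = (‖x‖ ^ (2 * k + 1)) ^ 2 := by
    rw [sq, ← CStarRing.norm_self_mul_star, star_mul, star_pow, hs.star_eq]
    have e : (x * star x) ^ k * x * (star x * (x * star x) ^ k) = (x * star x) ^ (2 * k + 1) := by
      rw [mul_assoc, ← mul_assoc x, ← pow_succ', ← pow_add]
      congr 1
      ring
    rw [e, norm_pow_of_isSelfAdjoint hs (by omega), CStarRing.norm_self_mul_star]
    ring
  exact (sq_eq_sq₀ (norm_nonneg _) (by positivity)).mp h1

end CStar

theorem exists_lt_pow_of_lt {C s t : ℝ} (hC : 0 ≤ C) (hs : 0 ≤ s) (hst : s < t) :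
    ∃ k : ℕ, C * s ^ (2 * k + 1) < t ^ (2 * k + 3) := by
  have ht : 0 < t := hs.trans_lt hst
  have hr0 : 0 ≤ s / t := by positivity
  have hr1 : s / t < 1 := (div_lt_one ht).mpr hst
  obtain ⟨k, hk⟩ := exists_pow_lt_of_lt_one (show 0 < t ^ 2 / (C + 1) by positivity) hr1
  refine ⟨k, ?_⟩
  have h1 : (s / t) ^ (2 * k + 1) < t ^ 2 / (C + 1) :=
    (pow_le_pow_of_le_one hr0 hr1.le (by omega)).trans_lt hk
  rw [lt_div_iff₀ (by positivity)] at h1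
  have h2 : C * (s / t) ^ (2 * k + 1) < t ^ 2 := by
    have : 0 ≤ (s / t) ^ (2 * k + 1) := by positivity
    nlinarith
  calc C * s ^ (2 * k + 1) = C * (s / t) ^ (2 * k + 1) * t ^ (2 * k + 1) := by
        rw [div_pow]; field_simp
    _ < t ^ 2 * t ^ (2 * k + 1) := mul_lt_mul_of_pos_right h2 (by positivity)
    _ = t ^ (2 * k + 3) := by ring

/-- If s < t then C D s^(2k+1) < t^(2k+3) for some k, because (s/t)^(2k+1) tends to 0. So neither a
value of `a` frequently below b nor one frequently above it survives the bounds for all k. -/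
theorem tendsto_of_odd_pow_bounds {a : ℕ → ℝ} {b C D : ℝ} (ha : ∀ i, 0 ≤ a i) (hb : 0 ≤ b)
    (hC : 0 ≤ C) (hD : 0 ≤ D)
    (hu : ∀ k : ℕ, ∀ ε > 0, ∀ᶠ i in atTop, a i ^ (2 * k + 3) ≤ C * (D * b ^ (2 * k + 1) + ε))
    (hl : ∀ k : ℕ, ∀ t : ℝ, (∃ᶠ i in atTop, a i ≤ t) →
      b ^ (2 * k + 3) ≤ C * (D * t ^ (2 * k + 1))) :
    Tendsto a atTop (𝓝 b) := by
  refine tendsto_order.mpr ⟨fun t ht => ?_, fun t ht => ?_⟩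
  · by_contra h
    have hf : ∃ᶠ i in atTop, a i ≤ t := by
      simpa [Filter.Frequently, not_le] using h
    obtain ⟨i, hi⟩ := hf.exists
    obtain ⟨k, hk⟩ := exists_lt_pow_of_lt (mul_nonneg hC hD) ((ha i).trans hi) ht
    have := hl k t hf
    rw [← mul_assoc] at this
    exact hk.not_ge this
  · obtain ⟨k, hk⟩ := exists_lt_pow_of_lt (mul_nonneg hC hD) hb ht
    set δ := t ^ (2 * k + 3) - C * D * b ^ (2 * k + 1)
    have hδ : 0 < δ := sub_pos.mpr hk
    -- Dividing by C + 1 keeps C · δ/(C + 1) < δ also when C = 0.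
    filter_upwards [hu k (δ / (C + 1)) (by positivity)] with i hi
    refine lt_of_pow_lt_pow_left₀ (2 * k + 3) (hb.trans ht.le) (hi.trans_lt ?_)
    have h1 : C * (δ / (C + 1)) < δ := by
      rw [mul_div_assoc', div_lt_iff₀ (by positivity)]
      nlinarith
    have h2 : t ^ (2 * k + 3) = δ + C * D * b ^ (2 * k + 1) := by simp [δ]
    rw [h2, mul_add, ← mul_assoc]
    linarith

/-! ### Uniformity over compact families. -/

section Uniform

variable {G : Type*} [Group G] [TopologicalSpace G] [IsTopologicalGroup G] {Γ : Subgroup G}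

omit [TopologicalSpace G] [IsTopologicalGroup G] in
theorem norm_groupAlgebraOp_translateSum_sub_le {V : Type*} [NormedAddCommGroup V]
    [InnerProductSpace ℂ V] [CompleteSpace V] (ρ : Γ →* unitary (V →L[ℂ] V)) (S : Finset Γ)
    (F : G → ℂ) (x y : G × G) :
    ‖groupAlgebraOp ρ (translateSum S F x.1 x.2) - groupAlgebraOp ρ (translateSum S F y.1 y.2)‖ ≤
      ∑ γ ∈ S, ‖F (x.1 * γ * x.2) - F (y.1 * γ * y.2)‖ := by
  refine ContinuousLinearMap.opNorm_le_bound _ (Finset.sum_nonneg fun _ _ => norm_nonneg _)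
    fun v => ?_
  rw [sub_apply, groupAlgebraOp_translateSum, groupAlgebraOp_translateSum,
    ← Finset.sum_sub_distrib, Finset.sum_mul]
  refine norm_sum_le_of_le _ fun γ _ => ?_
  rw [← sub_smul, norm_smul, Unitary.norm_map]

/-- Strong convergence gives an upper bound for the norms that is uniform over compact families of
elements of the group algebra. -/
theorem StronglyConverges.eventually_norm_translateSum_le
    {V : ℕ → Type*} [∀ i, NormedAddCommGroup (V i)] [∀ i, InnerProductSpace ℂ (V i)]
    [∀ i, CompleteSpace (V i)]
    {W : Type*} [NormedAddCommGroup W] [InnerProductSpace ℂ W] [CompleteSpace W]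
    {ρ : ∀ i, Γ →* unitary (V i →L[ℂ] V i)} {ρinf : Γ →* unitary (W →L[ℂ] W)}
    (hρ : StronglyConverges ρ ρinf) {S : Finset Γ} {F : G → ℂ} (hF : Continuous F)
    {K L : Set G} (hK : IsCompact K) (hL : IsCompact L) {B : ℝ}
    (hB : ∀ h ∈ K, ∀ g ∈ L, ‖groupAlgebraOp ρinf (translateSum S F h g)‖ ≤ B)
    {ε : ℝ} (hε : 0 < ε) :
    ∀ᶠ i in atTop, ∀ h ∈ K, ∀ g ∈ L,
      ‖groupAlgebraOp (ρ i) (translateSum S F h g)‖ ≤ B + ε := by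
  -- The ℓ¹ distance of the coefficients dominates the operator distance for every unitary ρ, so
  -- these neighbourhoods do not depend on i and finitely many sample points suffice.
  have hN : ∀ y ∈ K ×ˢ L, {x : G × G | ∑ γ ∈ S, ‖F (x.1 * γ * x.2) - F (y.1 * γ * y.2)‖ < ε / 2} ∈
      𝓝 y := fun y _ => by
    have hc : Continuous fun x : G × G =>
        ∑ γ ∈ S, ‖F (x.1 * γ * x.2) - F (y.1 * γ * y.2)‖ := by fun_prop
    refine hc.continuousAt.eventually_lt continuousAt_const ?_
    simpa using half_pos hε
  obtain ⟨t, ht, hcov⟩ := (hK.prod hL).elim_nhds_subcover _ hN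
  have h1 : ∀ᶠ i in atTop, ∀ y ∈ t,
      ‖groupAlgebraOp (ρ i) (translateSum S F y.1 y.2)‖ < B + ε / 2 := by
    rw [eventually_all_finset]
    intro y hy
    refine (hρ (translateSum S F y.1 y.2)).eventually_lt_const ?_
    have := hB y.1 (ht y hy).1 y.2 (ht y hy).2
    linarith
  filter_upwards [h1] with i hi h hh g hg
  obtain ⟨y, hy, hyx⟩ := Set.mem_iUnion₂.mp (hcov (show (h, g) ∈ K ×ˢ L from ⟨hh, hg⟩))
  have h2 := norm_groupAlgebraOp_translateSum_sub_le (ρ i) S F (h, g) y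
  have h3 := norm_le_norm_add_norm_sub (groupAlgebraOp (ρ i) (translateSum S F y.1 y.2))
    (groupAlgebraOp (ρ i) (translateSum S F h g))
  rw [norm_sub_rev] at h3
  have h4 := hi y hy
  simp only [Set.mem_ofPred_eq] at hyx h2
  linarith

end Uniform

/-! ### The two norm comparisons. -/

section Kernel

variable {G : Type*} [Group G] [TopologicalSpace G] [IsTopologicalGroup G]
  [MeasurableSpace G] [BorelSpace G]

/-- The function `(f * f^♯)^k * f`, for which `π` takes the value `(π(f) π(f)^*)^k π(f)`. -/
def oddPower (ν : Measure G) [IsFiniteMeasureOnCompacts ν] (f : C_c(G, ℂ)) : ℕ → C_c(G, ℂ)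
  | 0 => f
  | k + 1 => conv ν f (conv ν.inv (conjInv f) (oddPower ν f k))

variable (ν : Measure G) [IsFiniteMeasureOnCompacts ν] [ν.IsMulLeftInvariant] (f : C_c(G, ℂ))

theorem UnitaryRep.op_oddPower {H : Type*} [NormedAddCommGroup H] [InnerProductSpace ℂ H]
    [CompleteSpace H] (π : UnitaryRep G H) (k : ℕ) :
    π.op ν (oddPower ν f k) = (π.op ν f * star (π.op ν f)) ^ k * π.op ν f := by
  induction k with
  | zero => simp [oddPower]
  | succ k ih =>
    rw [oddPower, op_conv, op_conv, ih, ← adjoint_op, pow_succ', mul_assoc, mul_assoc]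

theorem UnitaryRep.norm_op_oddPower_succ {H : Type*} [NormedAddCommGroup H]
    [InnerProductSpace ℂ H] [CompleteSpace H] (π : UnitaryRep G H) (k : ℕ) :
    ‖π.op ν (oddPower ν f (k + 1))‖ = ‖π.op ν f‖ ^ (2 * k + 3) := by
  rw [op_oddPower, norm_mul_star_pow_mul]
  rfl

theorem exists_integral_norm_mul_le [LocallyCompactSpace G] (Γ : Subgroup G)
    [CompactSpace (G ⧸ Γ)] [MeasurableSpace (G ⧸ Γ)] [BorelSpace (G ⧸ Γ)]
    (μ : Measure (G ⧸ Γ)) [SMulInvariantMeasure G (G ⧸ Γ) μ] [IsFiniteMeasure μ] [NeZero μ]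
    {K : Set G} (hK : IsCompact K) :
    ∃ C : ℝ, 0 ≤ C ∧ ∀ (p : G ⧸ Γ → ℝ), Continuous p → 0 ≤ p → ∀ h ∈ K,
      ∫ y, ‖f y‖ * p ((y⁻¹ * h : G) : G ⧸ Γ) ∂ν ≤ C * ∫ x, p x ∂μ := by
  obtain ⟨C, hC, hCp⟩ := exists_setIntegral_inv_le ν Γ μ
    (hK.inv.mul f.hasCompactSupport.isCompact)
  obtain ⟨M, hM⟩ := f.hasCompactSupport.exists_bound_of_continuous f.continuous
  have hM1 : 0 < M + 1 := by linarith [(norm_nonneg _).trans (hM 1)]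
  refine ⟨(M + 1) * C, by positivity, fun p hp hp0 h hh => ?_⟩
  have hf := f.continuous
  have h1 := hCp p hp hp0 (fun a => ‖f (h * a)‖ / (M + 1)) (by fun_prop)
    (fun a => (div_le_one hM1).mpr (by linarith [hM (h * a)])) fun a ha => by
      rw [image_eq_zero_of_notMem_tsupport (fun h' => ha ⟨h⁻¹, Set.inv_mem_inv.mpr hh, _, h',
        by simp⟩)]
      simp
  rw [← integral_mul_left_eq_self _ h, mul_assoc]
  refine le_trans (le_of_eq ?_) (mul_le_mul_of_nonneg_left h1 hM1.le)
  rw [← integral_const_mul]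
  congr 1 with a
  rw [← mul_assoc, mul_div_cancel₀ _ hM1.ne']
  simp

namespace IndPre

variable {Γ : Subgroup G} [CompactSpace (G ⧸ Γ)] [MeasurableSpace (G ⧸ Γ)] [BorelSpace (G ⧸ Γ)]
  {μ : Measure (G ⧸ Γ)} [IsFiniteMeasure μ]
  {V : Type*} [NormedAddCommGroup V] [InnerProductSpace ℂ V] [CompleteSpace V]
  {ρ : Γ →* unitary (V →L[ℂ] V)}

-- Smearing by f gains regularity: the L¹ norm over G/Γ, hence the L² norm, controls a pointwise
-- value.
omit [ν.IsMulLeftInvariant] in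
theorem norm_smear_toMap_le {h : G} {C : ℝ} (hC0 : 0 ≤ C)
    (hC : ∀ (p : G ⧸ Γ → ℝ), Continuous p → 0 ≤ p →
      ∫ y, ‖f y‖ * p ((y⁻¹ * h : G) : G ⧸ Γ) ∂ν ≤ C * ∫ x, p x ∂μ) (φ : IndPre Γ μ ρ) :
    ‖(smear ν f φ).toMap h‖ ≤ C * (√(μ.real Set.univ) * ‖φ‖) := by
  rw [smear_toMap]
  refine (norm_integral_le_integral_norm _).trans ?_
  simp only [norm_smul, ← fiberNorm_mk]
  refine (hC _ (continuous_fiberNorm φ) fun x => Real.sqrt_nonneg _).trans ?_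
  exact mul_le_mul_of_nonneg_left (integral_fiberNorm_le φ) hC0

omit [BorelSpace (G ⧸ Γ)] [IsFiniteMeasure μ] [CompactSpace (G ⧸ Γ)] in
/-- Unfolding a smeared function along a partition of unity. -/
theorem smear_toMap_eq_integral {w : G → ℝ} (hw : Continuous w)
    (hw1 : ∀ g, ∑ᶠ γ : Γ, w (g * γ) = 1) {h : G} {S : Finset Γ}
    (hS : ∀ y ∈ (tsupport w)⁻¹, ∀ γ : Γ, γ ∉ S → f (h * γ * y) = 0) (φ : IndPre Γ μ ρ) :
    (smear ν f φ).toMap h =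
      ∫ y, (w y⁻¹ : ℂ) • groupAlgebraOp ρ (translateSum S f h y) (φ.toMap y⁻¹) ∂ν := by
  have hf := f.continuous
  have hint : ∀ γ : Γ,
      Integrable (fun y => (f (h * y) * (w (y⁻¹ * γ) : ℂ)) • φ.toMap y⁻¹) ν := fun γ => by
    refine Continuous.integrable_of_hasCompactSupport ?_ ?_
    · fun_prop
    · exact (f.hasCompactSupport.comp_homeomorph (Homeomorph.mulLeft h)).mul_right.smul_right
  have hint' : ∀ γ : Γ, Integrable
      (fun y => (w y⁻¹ : ℂ) • f (h * γ * y) • (ρ γ : V →L[ℂ] V) (φ.toMap y⁻¹)) ν := fun γ => by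
    refine ((hint γ).comp_mul_left (γ : G)).congr (Eventually.of_forall fun y => ?_)
    have e : φ.toMap (γ * y : G)⁻¹ = (ρ γ : V →L[ℂ] V) (φ.toMap y⁻¹) := by
      have := toMap_mul φ y⁻¹ γ⁻¹
      simpa using this
    simp only [e]
    rw [smul_smul, mul_comm]
    simp [mul_assoc]
  have hsum : ∀ y, f (h * y) • φ.toMap y⁻¹ =
      ∑ γ ∈ S, (f (h * y) * (w (y⁻¹ * γ) : ℂ)) • φ.toMap y⁻¹ := fun y => by
    rw [← Finset.sum_smul, ← Finset.mul_sum]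
    by_cases hy : f (h * y) = 0
    · simp [hy]
    congr 1
    have h1 : ∑ γ ∈ S, w (y⁻¹ * γ) = 1 := by
      rw [← hw1 y⁻¹, eq_comm]
      refine finsum_eq_sum_of_support_subset _ fun γ hγ => ?_
      by_contra hγS
      refine hy ?_
      have := hS (γ⁻¹ * y) (by
        rw [Set.mem_inv]
        exact subset_tsupport _ (by simpa using hγ)) γ hγS
      simpa [mul_assoc] using this
    rw [← Complex.ofReal_sum, h1, Complex.ofReal_one, mul_one]
  -- After y ↦ hy the integrand is f(hy) φ(y⁻¹). Inserting ∑ w(y⁻¹γ) = 1 and replacing y by γy in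
  -- the γ-th term produces w(y⁻¹) f(hγy) ρ(γ) φ(y⁻¹).
  rw [smear_toMap, ← integral_mul_left_eq_self _ h]
  have e1 : ∀ y, f (h * y) • φ.toMap ((h * y)⁻¹ * h) =
      ∑ γ ∈ S, (f (h * y) * (w (y⁻¹ * γ) : ℂ)) • φ.toMap y⁻¹ := fun y => by
    rw [← hsum]
    simp
  simp_rw [e1, groupAlgebraOp_translateSum, Finset.smul_sum]
  rw [integral_finsetSum _ fun γ _ => hint γ, integral_finsetSum _ fun γ _ => hint' γ]
  refine Finset.sum_congr rfl fun γ _ => ?_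
  rw [← integral_mul_left_eq_self _ (γ : G)]
  congr 1 with y
  have e : φ.toMap (γ * y : G)⁻¹ = (ρ γ : V →L[ℂ] V) (φ.toMap y⁻¹) := by
    have := toMap_mul φ y⁻¹ γ⁻¹
    simpa using this
  rw [e, smul_smul, mul_comm]
  simp [mul_assoc]

variable [T2Space G] [LocallyCompactSpace G] [DiscreteTopology Γ]

variable [SMulInvariantMeasure G (G ⧸ Γ) μ]

-- In the unfolded integral the kernel has norm at most B where w(y⁻¹) ≠ 0. One factor √μ(G/Γ) comes
-- from passing from L² to L¹, the other from sup norm on K back to L².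
omit [T2Space G] [DiscreteTopology Γ] in
theorem norm_op_le {w : G → ℝ} (hw : Continuous w) (hwc : HasCompactSupport w)
    (hw0 : ∀ g, 0 ≤ w g) (hw1 : ∀ g, ∑ᶠ γ : Γ, w (g * γ) = 1)
    {K : Set G} (hKΓ : ∀ g : G, ∃ γ : Γ, g * γ ∈ K) {C : ℝ} (hC0 : 0 ≤ C)
    (hC : ∀ (p : G ⧸ Γ → ℝ), Continuous p → 0 ≤ p →
      ∫ y, w y⁻¹ * p ((y⁻¹ : G) : G ⧸ Γ) ∂ν ≤ C * ∫ x, p x ∂μ)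
    {S : Finset Γ} (hS : ∀ h ∈ K, ∀ y ∈ (tsupport w)⁻¹, ∀ γ : Γ, γ ∉ S → f (h * γ * y) = 0)
    {B : ℝ} (hB0 : 0 ≤ B)
    (hB : ∀ h ∈ K, ∀ y ∈ (tsupport w)⁻¹, ‖groupAlgebraOp ρ (translateSum S f h y)‖ ≤ B) :
    ‖(Ind Γ μ ρ).op ν f‖ ≤ C * √(μ.real Set.univ) * √(μ.real Set.univ) * B := by
  refine ContinuousLinearMap.opNorm_le_bound _ (by positivity) fun v => ?_
  induction v using UniformSpace.Completion.induction_on with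
  | hp => exact isClosed_le (by fun_prop) (by fun_prop)
  | ih φ =>
    rw [op_coe, UniformSpace.Completion.norm_coe, UniformSpace.Completion.norm_coe]
    have key : ∀ h ∈ K, ‖(smear ν f φ).toMap h‖ ≤ B * (C * (√(μ.real Set.univ) * ‖φ‖)) := by
      intro h hh
      have hi : Integrable (fun y : G => w y⁻¹ * fiberNorm φ ((y⁻¹ : G) : G ⧸ Γ)) ν := by
        refine Continuous.integrable_of_hasCompactSupport ?_
          (hwc.comp_homeomorph (Homeomorph.inv G)).mul_right
        simp only [fiberNorm_mk]
        fun_prop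
      rw [smear_toMap_eq_integral ν f hw hw1 (hS h hh)]
      calc _ ≤ ∫ y, B * (w y⁻¹ * fiberNorm φ ((y⁻¹ : G) : G ⧸ Γ)) ∂ν := by
            refine norm_integral_le_of_norm_le (hi.const_mul B) (Eventually.of_forall fun y => ?_)
            rw [norm_smul, Complex.norm_real, Real.norm_of_nonneg (hw0 _), fiberNorm_mk,
              mul_left_comm]
            by_cases hy : y⁻¹ ∈ tsupport w
            · exact mul_le_mul_of_nonneg_left
                (ContinuousLinearMap.le_of_opNorm_le _ (hB h hh y hy) _) (hw0 _)
            · simp [image_eq_zero_of_notMem_tsupport hy]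
        _ ≤ B * (C * ∫ x, fiberNorm φ x ∂μ) := by
            rw [integral_const_mul]
            exact mul_le_mul_of_nonneg_left
              (hC _ (continuous_fiberNorm φ) fun x => Real.sqrt_nonneg _) hB0
        _ ≤ _ := by
            gcongr
            exact integral_fiberNorm_le φ
    refine (norm_le_of_forall_mem hKΓ _ (by positivity) key).trans_eq ?_
    ring

omit [ν.IsMulLeftInvariant] in
theorem coe_avg_rightTranslate_conv (σ : Measure G) [IsFiniteMeasureOnCompacts σ]
    (f u : C_c(G, ℂ)) (g : G) (v : V) :
    ((avg μ ρ (rightTranslate (conv σ f u) g) v : IndPre Γ μ ρ) : IndSpace Γ μ ρ) =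
      (Ind Γ μ ρ).op σ f (avg μ ρ (rightTranslate u g) v : IndPre Γ μ ρ) := by
  rw [op_coe, smear_avg, conv_rightTranslate]

omit [ν.IsMulLeftInvariant] in
theorem coe_avg_rightTranslate_oddPower (k : ℕ) (g : G) (v : V) :
    ((avg μ ρ (rightTranslate (oddPower ν f k) g) v : IndPre Γ μ ρ) : IndSpace Γ μ ρ) =
      (((Ind Γ μ ρ).op ν f * star ((Ind Γ μ ρ).op ν f)) ^ k)
        (avg μ ρ (rightTranslate f g) v : IndPre Γ μ ρ) := by
  induction k with
  | zero => simp [oddPower]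
  | succ k ih =>
    rw [oddPower, coe_avg_rightTranslate_conv, coe_avg_rightTranslate_conv, ih,
      ← UnitaryRep.adjoint_op, pow_succ']
    rfl

-- Of the 2k+3 factors of `oddPower ν f (k + 1)`, the leftmost is spent on the pointwise estimate
-- and the rightmost on the starting vector; the 2k+1 between them act as T*(TT*)^k.
omit [ν.IsMulLeftInvariant] in
theorem norm_groupAlgebraOp_oddPower_le {h g : G} {C : ℝ} (hC0 : 0 ≤ C)
    (hC : ∀ (p : G ⧸ Γ → ℝ), Continuous p → 0 ≤ p →
      ∫ y, ‖f y‖ * p ((y⁻¹ * h : G) : G ⧸ Γ) ∂ν ≤ C * ∫ x, p x ∂μ)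
    {D : ℝ} (hD0 : 0 ≤ D) (hD : ∀ v, ‖avg μ ρ (rightTranslate f g) v‖ ≤ D * ‖v‖) {k : ℕ}
    {S : Finset Γ} (hS : ∀ γ : Γ, γ ∉ S → oddPower ν f (k + 1) (h * γ * g) = 0) :
    ‖groupAlgebraOp ρ (translateSum S (oddPower ν f (k + 1)) h g)‖ ≤
      C * √(μ.real Set.univ) * D * ‖(Ind Γ μ ρ).op ν f‖ ^ (2 * k + 1) := by
  refine ContinuousLinearMap.opNorm_le_bound _ (by positivity) fun v => ?_
  set T := (Ind Γ μ ρ).op ν f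
  have hT : ‖star T * (T * star T) ^ k‖ = ‖T‖ ^ (2 * k + 1) := by
    rw [← norm_star, star_mul, star_pow, star_star, (IsSelfAdjoint.mul_star_self T).star_eq]
    exact norm_mul_star_pow_mul T k
  rw [← avg_rightTranslate_toMap (μ := μ) _ v h g hS, oddPower, ← conv_rightTranslate, ← smear_avg]
  refine (norm_smear_toMap_le ν f hC0 hC _).trans ?_
  rw [← UniformSpace.Completion.norm_coe, coe_avg_rightTranslate_conv,
    coe_avg_rightTranslate_oddPower, ← UnitaryRep.adjoint_op]
  have h1 := (star T * (T * star T) ^ k).le_opNorm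
    ((avg μ ρ (rightTranslate f g) v : IndPre Γ μ ρ) : IndSpace Γ μ ρ)
  rw [hT, UniformSpace.Completion.norm_coe] at h1
  calc _ ≤ C * (√(μ.real Set.univ) * (‖T‖ ^ (2 * k + 1) * (D * ‖v‖))) := by
        gcongr
        exact h1.trans (mul_le_mul_of_nonneg_left (hD v) (by positivity))
    _ = _ := by ring

end IndPre

end Kernel

/-! ### Assembly. -/

/-- Induction from a cocompact lattice preserves strong convergence. -/
theorem StronglyConverges.ind
    {G : Type*} [Group G] [TopologicalSpace G] [IsTopologicalGroup G]
    [LocallyCompactSpace G] [T2Space G] [MeasurableSpace G] [BorelSpace G]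
    (ν : Measure G) [IsFiniteMeasureOnCompacts ν] [ν.IsMulLeftInvariant]
    (Γ : Subgroup G) [DiscreteTopology Γ] [CompactSpace (G ⧸ Γ)]
    [MeasurableSpace (G ⧸ Γ)] [BorelSpace (G ⧸ Γ)]
    (μ : Measure (G ⧸ Γ)) [SMulInvariantMeasure G (G ⧸ Γ) μ]
    [IsFiniteMeasure μ] [NeZero μ]
    {V : ℕ → Type*} [∀ i, NormedAddCommGroup (V i)] [∀ i, InnerProductSpace ℂ (V i)]
    [∀ i, CompleteSpace (V i)]
    {W : Type*} [NormedAddCommGroup W] [InnerProductSpace ℂ W] [CompleteSpace W]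
    (ρ : ∀ i, Γ →* unitary (V i →L[ℂ] V i)) (ρinf : Γ →* unitary (W →L[ℂ] W))
    (h : StronglyConverges ρ ρinf) :
    UnitaryRep.StronglyConverges ν
      (fun i => Ind Γ μ (ρ i)) (Ind Γ μ ρinf) := by
  intro f
  obtain ⟨K, hK, hKΓ⟩ := exists_isCompact_forall_mul_mem Γ
  obtain ⟨w, hw, hwc, hw0, hw1, hwsum⟩ := exists_partition_of_unity Γ
  have hL : IsCompact (tsupport w)⁻¹ := hwc.isCompact.inv
  obtain ⟨C, hC0, hC⟩ := exists_setIntegral_inv_le ν Γ μ hL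
  obtain ⟨D, hD0, hD⟩ := exists_integral_norm_mul_le ν f Γ μ hK
  obtain ⟨M, hM⟩ := f.hasCompactSupport.exists_bound_of_continuous f.continuous
  have hM0 : 0 ≤ M := (norm_nonneg _).trans (hM 1)
  have hfin : ∀ F : C_c(G, ℂ), ∃ S : Finset Γ, ∀ h ∈ K, ∀ g ∈ (tsupport w)⁻¹, ∀ γ : Γ, γ ∉ S →
      F (h * γ * g) = 0 := fun F => by
    obtain ⟨S, hS⟩ := exists_finset_mul_mul_notMem Γ hK F.hasCompactSupport.isCompact hL
    exact ⟨S, fun h hh g hg γ hγ => image_eq_zero_of_notMem_tsupport (hS h hh g hg γ hγ)⟩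
  -- Only `S₀`, attached to f itself, enters the final constants. The sets `S k` may grow with k,
  -- since they merely truncate sums.
  obtain ⟨S₀, hS₀⟩ := hfin f
  choose S hS using fun k => hfin (oddPower ν f (k + 1))
  have hCw : ∀ (p : G ⧸ Γ → ℝ), Continuous p → 0 ≤ p →
      ∫ y, w y⁻¹ * p ((y⁻¹ : G) : G ⧸ Γ) ∂ν ≤ C * ∫ x, p x ∂μ := fun p hp hp0 =>
    hC p hp hp0 (fun y => w y⁻¹) (hw.comp continuous_inv) (fun y => hw1 _)
      fun y hy => image_eq_zero_of_notMem_tsupport hy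
  set m := √(μ.real Set.univ)
  have hm : 0 ≤ m := Real.sqrt_nonneg _
  refine tendsto_of_odd_pow_bounds (C := C * m * m) (D := D * m * (S₀.card * M * m))
    (fun i => norm_nonneg _) (norm_nonneg _) (by positivity) (by positivity)
    (fun k ε hε => ?_) fun k t ht => ?_
  · have hB : ∀ h ∈ K, ∀ g ∈ (tsupport w)⁻¹,
        ‖groupAlgebraOp ρinf (translateSum (S k) (oddPower ν f (k + 1)) h g)‖ ≤
          D * m * (S₀.card * M * m) * ‖(Ind Γ μ ρinf).op ν f‖ ^ (2 * k + 1) := fun h hh g hg =>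
      IndPre.norm_groupAlgebraOp_oddPower_le ν f hD0 (fun p hp hp0 => hD p hp hp0 h hh)
        (by positivity) (IndPre.norm_avg_le hKΓ hM fun h' hh' => hS₀ h' hh' g hg) (hS k h hh g hg)
    filter_upwards [h.eventually_norm_translateSum_le (oddPower ν f (k + 1)).continuous hK hL hB hε]
      with i hi
    rw [← UnitaryRep.norm_op_oddPower_succ]
    exact IndPre.norm_op_le ν _ hw hwc hw0 hwsum hKΓ hC0 hCw (hS k) (by positivity) hi
  -- Here the kernel bound holds for infinitely many ρ_i and passes to ρ_∞ for each (h, g)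
  -- separately, so no uniformity in (h, g) is needed.
  · have ht0 : 0 ≤ t := (norm_nonneg _).trans ht.exists.choose_spec
    rw [← UnitaryRep.norm_op_oddPower_succ]
    refine IndPre.norm_op_le ν _ hw hwc hw0 hwsum hKΓ hC0 hCw (hS k) (by positivity)
      fun h' hh' g hg => le_of_tendsto_of_frequently (h _) (ht.mono fun i hi => ?_)
    refine (IndPre.norm_groupAlgebraOp_oddPower_le (μ := μ) ν f hD0
      (fun p hp hp0 => hD p hp hp0 h' hh') (by positivity)
      (IndPre.norm_avg_le hKΓ hM fun h'' hh'' => hS₀ h'' hh'' g hg) (hS k h' hh' g hg)).trans ?_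
    gcongr

end StrongInduction

end

theorem mainTheorem2
    {G : Type*} [Group G] [TopologicalSpace G] [IsTopologicalGroup G]
    [LocallyCompactSpace G] [T2Space G] [MeasurableSpace G] [BorelSpace G]
    (ν : MeasureTheory.Measure G) [ν.IsHaarMeasure] [ν.Regular]
    (Γ : Subgroup G) [DiscreteTopology Γ] [CompactSpace (G ⧸ Γ)]
    [MeasurableSpace (G ⧸ Γ)] [BorelSpace (G ⧸ Γ)]
    (μ : MeasureTheory.Measure (G ⧸ Γ)) [MeasureTheory.SMulInvariantMeasure G (G ⧸ Γ) μ]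
    [MeasureTheory.IsFiniteMeasure μ] [μ.Regular] [NeZero μ]
    {V : ℕ → Type*} [∀ i, NormedAddCommGroup (V i)] [∀ i, InnerProductSpace ℂ (V i)]
    [∀ i, CompleteSpace (V i)]
    {W : Type*} [NormedAddCommGroup W] [InnerProductSpace ℂ W] [CompleteSpace W]
    (ρ : ∀ i, Γ →* unitary (V i →L[ℂ] V i)) (ρinf : Γ →* unitary (W →L[ℂ] W))
    (h : StrongInduction.StronglyConverges ρ ρinf) :
    StrongInduction.UnitaryRep.StronglyConverges ν
      (fun i => StrongInduction.Ind Γ μ (ρ i)) (StrongInduction.Ind Γ μ ρinf) :=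
  StrongInduction.StronglyConverges.ind ν Γ μ ρ ρinf h
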